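/- **Setting.** Let $\ell\ge 1$ and let $\Theta\subseteq\mathbb R^\ell$ be open and bounded. For each $\theta\in\Theta$ let $(Y_i(\theta))_{i\ge1}$ be independent real random variables on a probability space $(\Omega,\mathcal A,\mathbb P)$. Assume: (i) there is $q>\ell$ with $\sup_{\theta\in\Theta}\mathbb E[|Y_i(\theta)|^q]<\infty$ for every $i$, and the sequence is weakly $\ell$-stationary: $\mathbb E[Y_i(\theta)^j]=\mathbb E[Y_1(\theta)^j]=:M_j(\theta)$ for all $i\ge1$, $1\le j\le\ell$; (ii) $M=(M_1,\dots,M_\ell):\Theta\to M(\Theta)\subseteq\mathbb R^\ell$ is continuous and bijective; (iii) the inverse $M^{-1}$ is continuously differentiable on the open set $M(\Theta)$. Extend $M^{-1}$ arbitrarily to $\mathbb R^\ell$, fix $\theta_0\in\Theta$, and put $$\bar X_n=\Big(\frac1n\sum_{i=1}^nY_i(\theta_0)^j\Big)_{1\le j\le\ell},\qquad \hat\theta_n=M^{-1}(\bar X_n),\qquad \beta^*_{n,p}=\frac1n\sum_{i=1}^n\mathbb E[|Y_i(\theta_0)|^p].$$ Let $p>6\ell$, $n_0\ge1$, let $a=(a_n)_{n\ge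 n_0}$ be positive and nondecreasing and $\epsilon=(\varepsilon_n)_{n\ge n_0}$ positive and nonincreasing. Let $\|\cdot\|$ be the Euclidean norm, $B_r(x)$ the open ball, and $$K=\sum_{n=n_0}^\infty a_n\sum_{m=n}^\infty\frac{\beta^*_{m,p}}{\varepsilon_m^{p/\ell}\,m^{\frac p{2\ell}-1}},\qquad \mathcal O_\epsilon=\#\{n\ge n_0:\|\hat\theta_n-\theta_0\|>\varepsilon_n\},\qquad \mathcal S_{a}(N)=\sum_{k=0}^{N-1}a_{n_0+k}$$ for $N\in\mathbb N_0\cup\{\infty\}$, with $\mathcal S_a(0)=0$. **Theorem (method of moments with Cesàro-convergent $p$-th moments).** Suppose $K<\infty$. Then: 1. $\hat\theta_n\to\theta_0$ almost surely. 2. $\limsup_{n\to\infty}\|\hat\theta_n-\theta_0\|\,\varepsilon_n^{-1}\le1$ almost surely. 3. For every $\lambda>0$ (in particular for $\lambda$ slightly less than the smallest modulus of an eigenvalue of the Jacobi matrix of $M$ at $\theta_0$, if that matrix exists and is invertible) there are $\delta_1,\delta_2\in(0,1)$ such that $$M\big(\Theta\cap B_{\varepsilon_n}(\theta_0)\big)^c\subseteq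 B_{\delta_1\delta_2\lambda\varepsilon_n}(M(\theta_0))^c\qquad\text{for all }n\ge n_0.\qquad(\ast)$$ 4. For all $\lambda>0$ and $\delta_1,\delta_2\in(0,1)$ there are constants $C_1,C_2>0$, depending only on $\lambda,\delta_1,\delta_2,a,\epsilon,n_0,p,\ell$ (and not otherwise on the probability space, $\Theta$, the data, $M$ or $\theta_0$), such that whenever $(\ast)$ holds, $$\mathbb E[\mathcal S_a(\mathcal O_\epsilon)]\le C_1K+C_2.$$ -/

import Mathlib

open MeasureTheory ProbabilityTheory Filter Topology
open scoped ENNReal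

universe u

/-- The parameter and moment space `ℝ^ℓ` with the Euclidean norm. -/
abbrev Param (ℓ : ℕ) : Type := EuclideanSpace ℝ (Fin ℓ)

namespace MethodOfMoments

noncomputable section

/-- A sequence of real random variables is weakly `ℓ`-stationary if its moments of orders
`1, …, ℓ` do not depend on the index. -/
def WeaklyStationary {Ω : Type u} [MeasurableSpace Ω] (ℓ : ℕ) (P : Measure Ω)
    (Z : ℕ → Ω → ℝ) : Prop :=
  ∀ n j : ℕ, 1 ≤ j → j ≤ ℓ → ∫ ω, Z n ω ^ j ∂P = ∫ ω, Z 0 ω ^ j ∂P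

/-- The vector `M(θ) = (E[Y(θ)], E[Y(θ)^2], …, E[Y(θ)^ℓ])` of the first `ℓ` moments. The sequence
`Y_1, Y_2, …` is indexed from `0`, that is, `Y i` stands for `Y_{i+1}`. -/
def momentMap {ℓ : ℕ} {Ω : Type u} [MeasurableSpace Ω] (P : Measure Ω)
    (Y : ℕ → Param ℓ → Ω → ℝ) (θ : Param ℓ) : Param ℓ :=
  WithLp.toLp 2 fun j : Fin ℓ => ∫ ω, Y 0 θ ω ^ (j.val + 1) ∂P

/-- The vector of the first `ℓ` sample moments of the first `n` data,
with components `(1/n) ∑_{i ≤ n} Y_i(θ)^j`. -/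
def sampleMoments {ℓ : ℕ} {Ω : Type u} (Y : ℕ → Param ℓ → Ω → ℝ) (θ : Param ℓ)
    (n : ℕ) (ω : Ω) : Param ℓ :=
  WithLp.toLp 2 fun j : Fin ℓ => (n : ℝ)⁻¹ * ∑ i ∈ Finset.range n, Y i θ ω ^ (j.val + 1)

/-- The standing setting: a bounded open parameter set `Θ`, for each parameter in `Θ` a sequence of
independent weakly `ℓ`-stationary real random variables, and the assumptions on the moment map
`M` and its inverse. `Minv` is the inverse of `M` on `M(Θ)`; its values off `M(Θ)` are arbitrary. -/
structure Setting {ℓ : ℕ} {Ω : Type u} [MeasurableSpace Ω] (P : Measure Ω)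
    (Θ : Set (Param ℓ)) (Y : ℕ → Param ℓ → Ω → ℝ) (Minv : Param ℓ → Param ℓ) : Prop where
  isOpen : IsOpen Θ
  isBounded : Bornology.IsBounded Θ
  measurable : ∀ i, ∀ θ ∈ Θ, Measurable (Y i θ)
  indep : ∀ θ ∈ Θ, iIndepFun (fun i => Y i θ) P
  stationary : ∀ θ ∈ Θ, WeaklyStationary ℓ P (fun i => Y i θ)
  /-- Moments of some order `q > ℓ` are bounded in the parameter. -/
  moments : ∃ q : ℝ, (ℓ : ℝ) < q ∧ ∀ i, (⨆ θ ∈ Θ, ∫⁻ ω, ‖Y i θ ω‖ₑ ^ q ∂P) < ∞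
  /-- `M : Θ → M(Θ)` is continuous and bijective. -/
  continuousOn : ContinuousOn (momentMap P Y) Θ
  injOn : Set.InjOn (momentMap P Y) Θ
  leftInv : Set.LeftInvOn Minv (momentMap P Y) Θ
  /-- The inverse is continuously differentiable on the open set `M(Θ)`. (Openness is automatic,
  by invariance of domain; it is listed as part of the meaning of continuous differentiability.) -/
  isOpen_image : IsOpen (momentMap P Y '' Θ)
  contDiffOn : ContDiffOn ℝ 1 Minv (momentMap P Y '' Θ)

/-- The method-of-moments estimator `M⁻¹` of the sample moments, for data with parameter `θ₀`. -/
def estimator {ℓ : ℕ} {Ω : Type u} (Y : ℕ → Param ℓ → Ω → ℝ) (Minv : Param ℓ → Param ℓ)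
    (θ₀ : Param ℓ) (n : ℕ) (ω : Ω) : Param ℓ :=
  Minv (sampleMoments Y θ₀ n ω)

/-- The Cesàro mean `(1/n) ∑_{i ≤ n} E[|Y_i(θ₀)|^p]`, possibly infinite. -/
def cesaroMoment {ℓ : ℕ} {Ω : Type u} [MeasurableSpace Ω] (P : Measure Ω)
    (Y : ℕ → Param ℓ → Ω → ℝ) (θ₀ : Param ℓ) (p : ℝ) (n : ℕ) : ℝ≥0∞ :=
  (∑ i ∈ Finset.range n, ∫⁻ ω, ‖Y i θ₀ ω‖ₑ ^ p ∂P) / (n : ℝ≥0∞)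

/-- `K = ∑_{n ≥ n₀} a_n ∑_{m ≥ n} β_m / (ε_m^{p/ℓ} m^{p/(2ℓ) - 1})`, as an extended nonnegative
number, where `β_m` is the Cesàro mean of the `p`-th absolute moments. -/
def weightedSum {ℓ : ℕ} {Ω : Type u} [MeasurableSpace Ω] (P : Measure Ω)
    (Y : ℕ → Param ℓ → Ω → ℝ) (θ₀ : Param ℓ) (p : ℝ) (a ε : ℕ → ℝ) (n₀ : ℕ) : ℝ≥0∞ :=
  ∑' n : Set.Ici n₀, ENNReal.ofReal (a n) * ∑' m : Set.Ici (n : ℕ),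
    cesaroMoment P Y θ₀ p m /
      ENNReal.ofReal (ε m ^ (p / ℓ) * ((m : ℕ) : ℝ) ^ (p / (2 * ℓ) - 1))

/-- The overlap statistic: the number of `n ≥ n₀` with `‖θ̂_n - θ₀‖ > ε_n`. -/
def overlap {ℓ : ℕ} {Ω : Type u} (Y : ℕ → Param ℓ → Ω → ℝ) (Minv : Param ℓ → Param ℓ)
    (θ₀ : Param ℓ) (ε : ℕ → ℝ) (n₀ : ℕ) (ω : Ω) : ℕ∞ :=
  Set.encard {n : ℕ | n₀ ≤ n ∧ ε n < ‖estimator Y Minv θ₀ n ω - θ₀‖}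

open Classical in
/-- `S_{a,n₀}(N) = ∑_{k=0}^{N-1} a_{n₀+k}`, with `S(0) = 0` and the full series at `N = ∞`. -/
def antiderivative (a : ℕ → ℝ) (n₀ : ℕ) (N : ℕ∞) : ℝ≥0∞ :=
  ∑' k : ℕ, if (k : ℕ∞) < N then ENNReal.ofReal (a (n₀ + k)) else 0

/-- The reduction to the law of large numbers at scale `c`: for all `n ≥ n₀`, the complement of
`M(B_{ε_n}(θ₀))` lies in the complement of the ball `B_{c ε_n}(M(θ₀))`. -/
def Reduction {ℓ : ℕ} {Ω : Type u} [MeasurableSpace Ω] (P : Measure Ω)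
    (Θ : Set (Param ℓ)) (Y : ℕ → Param ℓ → Ω → ℝ) (θ₀ : Param ℓ) (ε : ℕ → ℝ) (n₀ : ℕ)
    (c : ℝ) : Prop :=
  ∀ n, n₀ ≤ n → (momentMap P Y '' (Θ ∩ Metric.ball θ₀ (ε n)))ᶜ ⊆
    (Metric.ball (momentMap P Y θ₀) (c * ε n))ᶜ

end

end MethodOfMoments

/-! Since `Minv` is Lipschitz near M(θ₀), an estimation error above ε_n forces the sample moments to
deviate from M(θ₀) by at least c ε_n (`exists_reduction`, `Reduction.le_norm_sub`). What remains is
a law of large numbers with rate. The powers Y_i^j, j ≤ ℓ, have moments of order r = p/ℓ > 2, so a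
Marcinkiewicz–Zygmund type inequality and Markov's inequality bound the deviation probability by a
constant times (β_n + correction) / (ε_n^r n^(r/2 - 1)) (`measure_sampleMoments_ge_le`).

The correction comes from |Y^j|^r ≤ 1 + |Y|^p for j < ℓ. It must be finite after summation: for ℓ ≥
2 openness of M(Θ) forces a positive second moment, which is the same for all indices by
stationarity; hence β_n is bounded below and the correction is dominated by a multiple of K
(`exists_lowerOrderTerm_le`). For ℓ = 1 there is none. The summed correction involves only ℓ, p, a,
ε, n₀, and therefore yields C₂.

Summability and Borel–Cantelli give the almost sure statements. For the mean bound, an overlap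
larger than k implies an exceedance at some m ≥ n₀ + k, so S_a of the overlap is at most a double
sum of indicators, whose expectation is a double sum of deviation probabilities
(`antiderivative_overlap_le`). -/

namespace MethodOfMoments

/-! ### Elementary expansion of |x + y|^r -/

/-- Young's inequality in the form needed to absorb the quadratic term of a Taylor expansion. -/
lemma sq_le_inv_add_rpow {r N : ℝ} (hr : 2 < r) (hN : 1 ≤ N) (t : ℝ) :
    t ^ 2 ≤ N⁻¹ + N ^ (r / 2 - 1) * |t| ^ r := by
  have hN0 : 0 < N := by linarith
  by_cases h : t ^ 2 ≤ N⁻¹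
  · have : 0 ≤ N ^ (r / 2 - 1) * |t| ^ r := by positivity
    linarith
  · push Not at h
    have ht : 1 ≤ N * t ^ 2 := by
      have := mul_le_mul_of_nonneg_left h.le hN0.le
      rwa [mul_inv_cancel₀ hN0.ne'] at this
    have key : N ^ (r / 2 - 1) * |t| ^ r = t ^ 2 * (N * t ^ 2) ^ (r / 2 - 1) := by
      have ht0 : t ≠ 0 := by rintro rfl; norm_num at ht
      have ht' : 0 < |t| := abs_pos.2 ht0
      rw [Real.mul_rpow hN0.le (sq_nonneg t), ← sq_abs t, ← Real.rpow_natCast |t| 2,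
        ← Real.rpow_mul ht'.le, mul_left_comm, ← Real.rpow_add ht']
      congr 2
      push_cast; ring
    rw [key]
    have h1 : 1 ≤ (N * t ^ 2) ^ (r / 2 - 1) := Real.one_le_rpow ht (by linarith)
    have := inv_pos.2 hN0
    nlinarith [sq_nonneg t]

/-- A second-order expansion of `|x + y| ^ r` with a free parameter `N`. -/
lemma abs_add_rpow_le {r N : ℝ} (hr : 2 < r) (hN : 1 ≤ N) (x y : ℝ) :
    |x + y| ^ r ≤ (1 + (r ^ 2 + 2 * (1 + r) ^ r) / N) * |x| ^ r + r * (x * |x| ^ (r - 2)) * y +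
      (r ^ 2 + 2 * (1 + r) ^ r) * N ^ (r / 2 - 1) * |y| ^ r := by
  have hN0 : 0 < N := by linarith
  have hr0 : 0 < r := by linarith
  have hNp : 1 ≤ N ^ (r / 2 - 1) := Real.one_le_rpow hN (by linarith)
  set C := (1 + r) ^ r with hC
  have hC0 : 0 < C := by positivity
  -- If y is small relative to x, factor out |x|^r and expand in t = y/x; otherwise every term is
  -- controlled by |y|^r alone.
  by_cases hxy : r * |y| ≤ |x|
  · rcases eq_or_ne x 0 with rfl | hx
    · have hy : y = 0 := by
        rw [abs_zero] at hxy
        have := abs_nonneg y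
        exact abs_eq_zero.1 (by nlinarith)
      subst hy
      simp [Real.zero_rpow hr0.ne']
    have hx' : 0 < |x| := abs_pos.2 hx
    obtain ⟨t, rfl⟩ : ∃ t, y = x * t := ⟨y / x, by field_simp⟩
    have ht : r * |t| ≤ 1 := by
      rw [abs_mul] at hxy
      by_contra! h
      nlinarith
    have hrt : |r * t| ≤ 1 := by rwa [abs_mul, abs_of_pos hr0]
    have h1t : 0 ≤ 1 + t := by
      have := neg_abs_le t
      have := abs_nonneg t
      nlinarith
    -- Uses 1 + t ≤ e^t and e^u ≤ 1 + u + u² for |u| ≤ 1, with u = rt.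
    have e1 : |1 + t| ^ r ≤ 1 + r * t + r ^ 2 * t ^ 2 := by
      rw [abs_of_nonneg h1t]
      calc (1 + t) ^ r ≤ (Real.exp t) ^ r := by
            refine Real.rpow_le_rpow h1t ?_ hr0.le
            linarith [Real.add_one_le_exp t]
        _ = Real.exp (r * t) := by rw [← Real.exp_mul, mul_comm]
        _ ≤ _ := by
            have := (abs_le.1 (Real.abs_exp_sub_one_sub_id_le hrt)).2
            nlinarith
    have e2 := sq_le_inv_add_rpow hr hN t
    have e3 : |x| ^ r = |x| ^ (r - 2) * x ^ 2 := by
      rw [← sq_abs x, ← Real.rpow_natCast |x| 2, ← Real.rpow_add hx']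
      congr 1; push_cast; ring
    have e4 : |x + x * t| ^ r = |x| ^ r * |1 + t| ^ r := by
      rw [← Real.mul_rpow (abs_nonneg _) (abs_nonneg _), ← abs_mul]; ring_nf
    have e5 : |x * t| ^ r = |x| ^ r * |t| ^ r := by
      rw [← Real.mul_rpow (abs_nonneg _) (abs_nonneg _), ← abs_mul]
    have e6 : r * (x * |x| ^ (r - 2)) * (x * t) = |x| ^ r * (r * t) := by rw [e3]; ring
    rw [e4, e5, e6]
    have hX : 0 ≤ |x| ^ r := by positivity
    have e7 : 1 + r * t + r ^ 2 * t ^ 2 ≤ 1 + (r ^ 2 + 2 * C) / N + r * t +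
        (r ^ 2 + 2 * C) * N ^ (r / 2 - 1) * |t| ^ r := by
      have h2 : (r ^ 2 + 2 * C) * t ^ 2 ≤
          (r ^ 2 + 2 * C) * (N⁻¹ + N ^ (r / 2 - 1) * |t| ^ r) :=
        mul_le_mul_of_nonneg_left e2 (by positivity)
      have h3 : 0 ≤ 2 * C * t ^ 2 := by positivity
      rw [div_eq_mul_inv]
      linarith
    have e8 := mul_le_mul_of_nonneg_left (e1.trans e7) hX
    linarith
  · push Not at hxy
    have hy : 0 < |y| := by
      have := abs_nonneg x
      by_contra! h
      nlinarith
    have hY : 0 ≤ |y| ^ r := by positivity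
    have e1 : |x + y| ^ r ≤ C * |y| ^ r := by
      rw [hC, ← Real.mul_rpow (by positivity) (abs_nonneg _)]
      refine Real.rpow_le_rpow (abs_nonneg _) ?_ hr0.le
      linarith [abs_add_le x y]
    -- The linear term may be negative on the right-hand side, which is why the constant contains (1
    -- + r)^r twice.
    have e2 : -(r * (x * |x| ^ (r - 2)) * y) ≤ C * |y| ^ r := by
      calc -(r * (x * |x| ^ (r - 2)) * y) ≤ |r * (x * |x| ^ (r - 2)) * y| := neg_le_abs _
        _ = r * (|x| * |x| ^ (r - 2)) * |y| := by
            rw [abs_mul, abs_mul, abs_mul, abs_of_pos hr0,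
              abs_of_nonneg (Real.rpow_nonneg (abs_nonneg x) (r - 2))]
        _ ≤ r * ((r * |y|) * (r * |y|) ^ (r - 2)) * |y| := by
            have := Real.rpow_le_rpow (abs_nonneg x) hxy.le (by linarith : 0 ≤ r - 2)
            gcongr
        _ = (r * |y|) ^ r := by
            have h : 0 < r * |y| := by positivity
            have : (r * |y|) ^ r = (r * |y|) ^ (r - 2) * (r * |y|) ^ (2 : ℝ) := by
              rw [← Real.rpow_add h]; congr 1; ring
            rw [this]; norm_cast; ring
        _ = r ^ r * |y| ^ r := Real.mul_rpow hr0.le (abs_nonneg _)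
        _ ≤ C * |y| ^ r := by
            refine mul_le_mul_of_nonneg_right ?_ hY
            exact Real.rpow_le_rpow hr0.le (by linarith) hr0.le
    have e3 : 0 ≤ (r ^ 2 + 2 * C) / N * |x| ^ r := by positivity
    have e4 : 0 ≤ |x| ^ r := by positivity
    have e5 : 2 * C * |y| ^ r ≤ (r ^ 2 + 2 * C) * N ^ (r / 2 - 1) * |y| ^ r := by
      refine mul_le_mul_of_nonneg_right ?_ hY
      nlinarith [sq_nonneg r]
    linarith

/-! ### Absolute moments of sums of independent centered variables -/

section Moments

variable {Ω : Type u} [MeasurableSpace Ω] {P : Measure Ω}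

lemma integrable_abs_rpow {r : ℝ} (hr : 0 < r) {f : Ω → ℝ} (hf : MemLp f (ENNReal.ofReal r) P) :
    Integrable (fun ω => |f ω| ^ r) P := by
  have := hf.integrable_norm_rpow (by simpa using hr) ENNReal.ofReal_ne_top
  simpa [ENNReal.toReal_ofReal hr.le] using this

variable [IsProbabilityMeasure P]

/-- The modulus is |f|^(r - 1) ≤ 1 + |f|^r. This makes the linear term of the expansion integrable,
so that independence can remove it. -/
lemma integrable_mul_abs_rpow {r : ℝ} (hr : 2 < r) {f : Ω → ℝ} (hfm : Measurable f)
    (hf : MemLp f (ENNReal.ofReal r) P) :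
    Integrable (fun ω => f ω * |f ω| ^ (r - 2)) P := by
  refine ((integrable_const (1 : ℝ)).add (integrable_abs_rpow (by linarith) hf)).mono'
    (by fun_prop) (ae_of_all _ fun ω => ?_)
  rw [Real.norm_eq_abs, abs_mul, abs_of_nonneg (Real.rpow_nonneg (abs_nonneg (f ω)) (r - 2))]
  simp only [Pi.add_apply]
  rcases le_total |f ω| 1 with h | h
  · have h1 := Real.rpow_le_one (abs_nonneg (f ω)) h (by linarith : 0 ≤ r - 2)
    have h2 : 0 ≤ |f ω| ^ r := by positivity
    have h3 : 0 ≤ |f ω| ^ (r - 2) := by positivity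
    nlinarith [abs_nonneg (f ω)]
  · have h0 : 0 < |f ω| := by linarith
    have h1 : |f ω| * |f ω| ^ (r - 2) = |f ω| ^ (r - 1) := by
      rw [← Real.rpow_one_add' h0.le (by linarith)]; congr 1; ring
    have h2 := Real.rpow_le_rpow_of_exponent_le h (by linarith : r - 1 ≤ r)
    rw [h1]; linarith

/-- One step of the recursion for the absolute moments of sums of independent variables. -/
lemma integral_abs_add_rpow_le {r N : ℝ} (hr : 2 < r) (hN : 1 ≤ N) {S Z : Ω → ℝ}
    (hSm : Measurable S) (hSZ : IndepFun S Z P)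
    (hS : MemLp S (ENNReal.ofReal r) P) (hZ : MemLp Z (ENNReal.ofReal r) P)
    (hZ0 : ∫ ω, Z ω ∂P = 0) :
    ∫ ω, |S ω + Z ω| ^ r ∂P ≤ (1 + (r ^ 2 + 2 * (1 + r) ^ r) / N) * ∫ ω, |S ω| ^ r ∂P +
      (r ^ 2 + 2 * (1 + r) ^ r) * N ^ (r / 2 - 1) * ∫ ω, |Z ω| ^ r ∂P := by
  have hr0 : 0 < r := by linarith
  set C := r ^ 2 + 2 * (1 + r) ^ r
  have hZi : Integrable Z P := hZ.integrable (by
    rw [← ENNReal.ofReal_one]; exact ENNReal.ofReal_le_ofReal (by linarith))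
  have hind : IndepFun (fun ω => S ω * |S ω| ^ (r - 2)) Z P :=
    hSZ.comp (φ := fun x : ℝ => x * |x| ^ (r - 2)) (by fun_prop) measurable_id
  have hgi := integrable_mul_abs_rpow hr hSm hS
  have hcross : ∫ ω, (S ω * |S ω| ^ (r - 2)) * Z ω ∂P = 0 := by
    rw [hind.integral_fun_mul_eq_mul_integral hgi.1 hZi.1, hZ0, mul_zero]
  have hci : Integrable (fun ω => (S ω * |S ω| ^ (r - 2)) * Z ω) P := hind.integrable_mul hgi hZi
  have i1 := integrable_abs_rpow hr0 hS
  have i2 := integrable_abs_rpow hr0 hZ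
  have i3 : Integrable (fun ω => |S ω + Z ω| ^ r) P := integrable_abs_rpow hr0 (hS.add hZ)
  calc ∫ ω, |S ω + Z ω| ^ r ∂P
      ≤ ∫ ω, ((1 + C / N) * |S ω| ^ r + r * ((S ω * |S ω| ^ (r - 2)) * Z ω) +
          C * N ^ (r / 2 - 1) * |Z ω| ^ r) ∂P := by
        refine integral_mono i3 (((i1.const_mul _).add (hci.const_mul _)).add (i2.const_mul _))
          fun ω => ?_
        have := abs_add_rpow_le hr hN (S ω) (Z ω)
        simp only at this ⊢
        linarith
    _ = _ := by
        rw [integral_add (f := fun ω => (1 + C / N) * |S ω| ^ r +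
            r * ((S ω * |S ω| ^ (r - 2)) * Z ω)) ((i1.const_mul _).add (hci.const_mul _))
            (i2.const_mul _),
          integral_add (i1.const_mul _) (hci.const_mul _), integral_const_mul, integral_const_mul,
          integral_const_mul, hcross]
        ring

/-- A Marcinkiewicz–Zygmund type inequality: the `r`-th absolute moment of a sum of `n` independent
centered variables is at most of order `n ^ (r / 2 - 1)` times the sum of their `r`-th moments. -/
lemma integral_abs_sum_rpow_le {r : ℝ} (hr : 2 < r) {Z : ℕ → Ω → ℝ}
    (hZm : ∀ i, Measurable (Z i)) (hind : iIndepFun Z P)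
    (hZ : ∀ i, MemLp (Z i) (ENNReal.ofReal r) P) (hZ0 : ∀ i, ∫ ω, Z i ω ∂P = 0)
    {n : ℕ} (hn : 1 ≤ n) :
    ∫ ω, |∑ i ∈ Finset.range n, Z i ω| ^ r ∂P ≤
      Real.exp (r ^ 2 + 2 * (1 + r) ^ r) * (r ^ 2 + 2 * (1 + r) ^ r) *
        ((n : ℝ) ^ (r / 2 - 1) * ∑ i ∈ Finset.range n, ∫ ω, |Z i ω| ^ r ∂P) := by
  set C := r ^ 2 + 2 * (1 + r) ^ r with hC
  have hC0 : 0 ≤ C := by positivity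
  have hn1 : (1 : ℝ) ≤ n := by exact_mod_cast hn
  have hb : ∀ i, 0 ≤ ∫ ω, |Z i ω| ^ r ∂P := fun i => integral_nonneg fun ω => by positivity
  have step : ∀ m : ℕ, ∫ ω, |∑ i ∈ Finset.range m, Z i ω| ^ r ∂P ≤ (1 + C / n) ^ m *
      (C * (n : ℝ) ^ (r / 2 - 1) * ∑ i ∈ Finset.range m, ∫ ω, |Z i ω| ^ r ∂P) := by
    intro m
    induction m with
    | zero => simp [Real.zero_rpow (by linarith : r ≠ 0)]
    | succ m ih =>
      have hI : IndepFun (fun ω => ∑ i ∈ Finset.range m, Z i ω) (Z m) P := by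
        have := hind.indepFun_finsetSum_of_notMem hZm (s := Finset.range m) (i := m) (by simp)
        convert this using 1
        ext ω; simp
      have h := integral_abs_add_rpow_le hr hn1 (S := fun ω => ∑ i ∈ Finset.range m, Z i ω)
        (Finset.measurable_sum _ fun i _ => hZm i) hI (memLp_finsetSum _ fun i _ => hZ i)
        (hZ m) (hZ0 m)
      rw [← hC] at h
      simp only [Finset.sum_range_succ]
      -- The free parameter is the final n at every step, so n growth factors multiply to at most
      -- e^C; the new summand is simply enlarged by the accumulated factor.
      have hq : (1 : ℝ) ≤ (1 + C / n) ^ (m + 1) := one_le_pow₀ (by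
        have : 0 ≤ C / n := by positivity
        linarith)
      have h1 := mul_le_mul_of_nonneg_left ih (by positivity : 0 ≤ 1 + C / n)
      have h2 : C * (n : ℝ) ^ (r / 2 - 1) * ∫ ω, |Z m ω| ^ r ∂P ≤
          (1 + C / n) ^ (m + 1) * (C * (n : ℝ) ^ (r / 2 - 1) * ∫ ω, |Z m ω| ^ r ∂P) :=
        le_mul_of_one_le_left (mul_nonneg (by positivity) (hb m)) hq
      calc _ ≤ _ := h
        _ ≤ _ := add_le_add h1 h2
        _ = _ := by rw [pow_succ]; ring
  refine (step n).trans ?_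
  have hexp : (1 + C / n) ^ n ≤ Real.exp C := by
    calc (1 + C / n) ^ n ≤ (Real.exp (C / n)) ^ n := by
          refine pow_le_pow_left₀ (by positivity) ?_ n
          linarith [Real.add_one_le_exp (C / n)]
      _ = Real.exp C := by
          rw [← Real.exp_nat_mul]; congr 1; field_simp
  have hs : 0 ≤ ∑ i ∈ Finset.range n, ∫ ω, |Z i ω| ^ r ∂P := Finset.sum_nonneg fun i _ => hb i
  calc _ ≤ Real.exp C * (C * (n : ℝ) ^ (r / 2 - 1) *
        ∑ i ∈ Finset.range n, ∫ ω, |Z i ω| ^ r ∂P) :=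
        mul_le_mul_of_nonneg_right hexp (by positivity)
    _ = _ := by ring

/-- The `r`-th moment of a centered variable in terms of the variable itself. -/
lemma integral_abs_sub_integral_rpow_le {r : ℝ} (hr : 1 ≤ r) {W : Ω → ℝ}
    (hW : MemLp W (ENNReal.ofReal r) P) :
    ∫ ω, |W ω - ∫ ω', W ω' ∂P| ^ r ∂P ≤ 2 ^ r * ∫ ω, |W ω| ^ r ∂P := by
  have hr0 : 0 < r := by linarith
  have hWi : Integrable W P := hW.integrable (by
    rw [← ENNReal.ofReal_one]; exact ENNReal.ofReal_le_ofReal hr)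
  have i1 := integrable_abs_rpow hr0 hW
  set μ := ∫ ω', W ω' ∂P
  have hmean : |μ| ^ r ≤ ∫ ω, |W ω| ^ r ∂P := by
    have h1 : |μ| ≤ ∫ ω, |W ω| ∂P := abs_integral_le_integral_abs
    have h2 := (convexOn_rpow hr).map_integral_le (μ := P) (f := fun ω => |W ω|)
      (Real.continuous_rpow_const hr0.le).continuousOn isClosed_Ici
      (ae_of_all _ fun ω => Set.mem_Ici.2 (abs_nonneg (W ω))) hWi.abs i1
    exact (Real.rpow_le_rpow (abs_nonneg _) h1 hr0.le).trans h2
  have i2 : Integrable (fun ω => |W ω - μ| ^ r) P :=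
    integrable_abs_rpow hr0 (hW.sub (memLp_const μ))
  have hpt : ∀ ω, |W ω - μ| ^ r ≤ 2 ^ (r - 1) * |W ω| ^ r + 2 ^ (r - 1) * |μ| ^ r := by
    intro ω
    calc |W ω - μ| ^ r ≤ (|W ω| + |μ|) ^ r :=
          Real.rpow_le_rpow (abs_nonneg _) (abs_sub _ _) hr0.le
      _ ≤ 2 ^ (r - 1) * (|W ω| ^ r + |μ| ^ r) :=
          mod_cast NNReal.rpow_add_le_mul_rpow_add_rpow ⟨|W ω|, abs_nonneg _⟩ ⟨|μ|, abs_nonneg _⟩ hr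
      _ = _ := by ring
  calc _ ≤ ∫ ω, (2 ^ (r - 1) * |W ω| ^ r + 2 ^ (r - 1) * |μ| ^ r) ∂P :=
        integral_mono i2 ((i1.const_mul _).add (integrable_const _)) hpt
    _ = 2 ^ (r - 1) * ∫ ω, |W ω| ^ r ∂P + 2 ^ (r - 1) * |μ| ^ r := by
        rw [integral_add (i1.const_mul _) (integrable_const _), integral_const_mul]; simp
    _ ≤ 2 ^ (r - 1) * ∫ ω, |W ω| ^ r ∂P + 2 ^ (r - 1) * ∫ ω, |W ω| ^ r ∂P := by gcongr
    _ = _ := by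
        have : (2 : ℝ) ^ r = 2 ^ (r - 1) * 2 := by
          rw [← Real.rpow_add_one (by norm_num)]; ring_nf
        rw [this]; ring

end Moments

/-! ### Deviation inequalities for sample moments -/

section Deviation

variable {Ω : Type u} [MeasurableSpace Ω] {P : Measure Ω}

lemma lintegral_enorm_rpow_eq {p : ℝ} (hp : 0 < p) {f : Ω → ℝ} (hf : Measurable f)
    (hfin : ∫⁻ ω, ‖f ω‖ₑ ^ p ∂P < ∞) :
    Integrable (fun ω => |f ω| ^ p) P ∧
      ∫⁻ ω, ‖f ω‖ₑ ^ p ∂P = ENNReal.ofReal (∫ ω, |f ω| ^ p ∂P) := by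
  have h : ∀ ω, ‖f ω‖ₑ ^ p = ENNReal.ofReal (|f ω| ^ p) := fun ω => by
    rw [← ENNReal.ofReal_rpow_of_nonneg (abs_nonneg _) hp.le, ← Real.norm_eq_abs,
      ofReal_norm]
  simp only [h] at hfin ⊢
  have hi : Integrable (fun ω => |f ω| ^ p) P := by
    refine ⟨(by fun_prop : Measurable _).aestronglyMeasurable, ?_⟩
    rw [hasFiniteIntegral_iff_ofReal (ae_of_all _ fun ω => by positivity)]
    exact hfin
  exact ⟨hi, (ofReal_integral_eq_lintegral_ofReal hi (ae_of_all _ fun ω => by positivity)).symm⟩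

variable [IsProbabilityMeasure P]

/-- The constant of the deviation inequality for sample means with moments of order `r`. -/
noncomputable def meanConst (r : ℝ) : ℝ :=
  Real.exp (r ^ 2 + 2 * (1 + r) ^ r) * (r ^ 2 + 2 * (1 + r) ^ r) * 2 ^ r

lemma meanConst_pos {r : ℝ} (hr : 0 < r) : 0 < meanConst r := by
  unfold meanConst; positivity

/-- A deviation inequality for means of independent variables with a common expectation. -/
lemma measure_mean_sub_ge_le {r : ℝ} (hr : 2 < r) {W : ℕ → Ω → ℝ} (hWm : ∀ i, Measurable (W i))
    (hind : iIndepFun W P) (hW : ∀ i, MemLp (W i) (ENNReal.ofReal r) P) {μ : ℝ}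
    (hμ : ∀ i, ∫ ω, W i ω ∂P = μ) {n : ℕ} (hn : 1 ≤ n) {s : ℝ} (hs : 0 < s) :
    P {ω | s ≤ |(n : ℝ)⁻¹ * ∑ i ∈ Finset.range n, W i ω - μ|} ≤
      ENNReal.ofReal (meanConst r * ((n : ℝ)⁻¹ * ∑ i ∈ Finset.range n, ∫ ω, |W i ω| ^ r ∂P) /
        (s ^ r * (n : ℝ) ^ (r / 2))) := by
  have hr0 : 0 < r := by linarith
  have hn0 : (0 : ℝ) < n := by exact_mod_cast hn
  set Z : ℕ → Ω → ℝ := fun i ω => W i ω - μ with hZdef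
  have hZm : ∀ i, Measurable (Z i) := fun i => (hWm i).sub_const μ
  have hZ : ∀ i, MemLp (Z i) (ENNReal.ofReal r) P := fun i => (hW i).sub (memLp_const μ)
  have hWi : ∀ i, Integrable (W i) P := fun i => (hW i).integrable (by
    rw [← ENNReal.ofReal_one]; exact ENNReal.ofReal_le_ofReal (by linarith))
  have hZ0 : ∀ i, ∫ ω, Z i ω ∂P = 0 := fun i => by
    simp [hZdef, integral_sub (hWi i) (integrable_const μ), hμ i]
  have hZind : iIndepFun Z P :=
    hind.comp (fun _ x => x - μ) fun _ => measurable_id.sub_const μ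
  have hsum := integral_abs_sum_rpow_le hr hZm hZind hZ hZ0 hn
  have hb : ∀ i, ∫ ω, |Z i ω| ^ r ∂P ≤ 2 ^ r * ∫ ω, |W i ω| ^ r ∂P := fun i => by
    have := integral_abs_sub_integral_rpow_le (by linarith : 1 ≤ r) (hW i)
    rwa [hμ i] at this
  have hset : {ω | s ≤ |(n : ℝ)⁻¹ * ∑ i ∈ Finset.range n, W i ω - μ|} ⊆
      {ω | (n * s) ^ r ≤ |∑ i ∈ Finset.range n, Z i ω| ^ r} := by
    intro ω hω
    simp only [Set.mem_ofPred_eq] at hω ⊢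
    refine Real.rpow_le_rpow (by positivity) ?_ hr0.le
    have : ∑ i ∈ Finset.range n, Z i ω = n * ((n : ℝ)⁻¹ * ∑ i ∈ Finset.range n, W i ω - μ) := by
      simp only [hZdef, Finset.sum_sub_distrib, Finset.sum_const, Finset.card_range, nsmul_eq_mul]
      field_simp
    rw [this, abs_mul, abs_of_pos hn0]
    gcongr
  have hint : Integrable (fun ω => |∑ i ∈ Finset.range n, Z i ω| ^ r) P :=
    integrable_abs_rpow hr0 (memLp_finsetSum _ fun i _ => hZ i)
  have hmarkov := mul_meas_ge_le_integral_of_nonneg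
    (ae_of_all P fun ω => Real.rpow_nonneg (abs_nonneg (∑ i ∈ Finset.range n, Z i ω)) r) hint
    ((n * s) ^ r)
  rw [← ofReal_measureReal]
  refine ENNReal.ofReal_le_ofReal ?_
  have hmono := measureReal_mono (μ := P) hset
  have hns : 0 < (n * s) ^ r := by positivity
  have hsb : ∑ i ∈ Finset.range n, ∫ ω, |Z i ω| ^ r ∂P ≤
      2 ^ r * ∑ i ∈ Finset.range n, ∫ ω, |W i ω| ^ r ∂P := by
    rw [Finset.mul_sum]; exact Finset.sum_le_sum fun i _ => hb i
  rw [le_div_iff₀ (by positivity)]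
  set B := ∑ i ∈ Finset.range n, ∫ ω, |W i ω| ^ r ∂P
  set C := Real.exp (r ^ 2 + 2 * (1 + r) ^ r) * (r ^ 2 + 2 * (1 + r) ^ r) with hC
  have hC0 : 0 ≤ C := by positivity
  have hpow : (n * s) ^ r = s ^ r * (n : ℝ) ^ (r / 2) * ((n : ℝ) ^ (r / 2 - 1) * n) := by
    rw [Real.mul_rpow hn0.le hs.le, ← Real.rpow_add_one hn0.ne', sub_add_cancel, mul_assoc,
      ← Real.rpow_add hn0, add_halves, mul_comm]
  have hq : 0 < (n : ℝ) ^ (r / 2 - 1) * n := by positivity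
  refine le_of_mul_le_mul_right ?_ hq
  calc _ = (n * s) ^ r * P.real {ω | s ≤ |(n : ℝ)⁻¹ * ∑ i ∈ Finset.range n, W i ω - μ|} := by
        rw [hpow]; ring
    _ ≤ (n * s) ^ r * P.real {ω | (n * s) ^ r ≤ |∑ i ∈ Finset.range n, Z i ω| ^ r} :=
        mul_le_mul_of_nonneg_left hmono hns.le
    _ ≤ C * ((n : ℝ) ^ (r / 2 - 1) * (2 ^ r * B)) := by
        refine hmarkov.trans (hsum.trans ?_)
        gcongr
    _ = _ := by
        rw [meanConst, ← hC]; field_simp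

/-- The correction that is needed unless all sample moments have order `ℓ = 1`. -/
def lowerOrderTerm (ℓ : ℕ) : ℕ := if ℓ = 1 then 0 else 1

/-- For j = ℓ the exponents match exactly; for j < ℓ the exponent jp/ℓ is at most p, and the
constant 1 covers |y| ≤ 1. With ℓ = 1 only the exact case occurs, so no constant is needed. -/
lemma abs_pow_rpow_le {ℓ : ℕ} {p : ℝ} (hp : 0 < p) {j : ℕ} (hj1 : 1 ≤ j) (hj : j ≤ ℓ) (y : ℝ) :
    |y ^ j| ^ (p / ℓ) ≤ lowerOrderTerm ℓ + |y| ^ p := by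
  have hℓ : (0 : ℝ) < ℓ := by exact_mod_cast (by omega : 0 < ℓ)
  rw [abs_pow, ← Real.rpow_natCast, ← Real.rpow_mul (abs_nonneg y)]
  rcases hj.eq_or_lt with rfl | hlt
  · have : (j : ℝ) * (p / j) = p := by field_simp
    rw [this]
    have : (0 : ℝ) ≤ lowerOrderTerm j := Nat.cast_nonneg _
    linarith
  · have h1 : (lowerOrderTerm ℓ : ℝ) = 1 := by
      rw [lowerOrderTerm, if_neg (by omega)]; simp
    have hle : (j : ℝ) * (p / ℓ) ≤ p := by
      rw [mul_div_assoc', div_le_iff₀ hℓ, mul_comm]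
      have : (j : ℝ) ≤ ℓ := by exact_mod_cast hj
      gcongr
    rw [h1]
    have hyp : 0 ≤ |y| ^ p := by positivity
    rcases le_total |y| 1 with h | h
    · have := Real.rpow_le_one (abs_nonneg y) h (by positivity : 0 ≤ (j : ℝ) * (p / ℓ))
      linarith
    · have := Real.rpow_le_rpow_of_exponent_le h hle
      linarith

/-- If all coordinates were smaller, the squared norm would be below s²/ℓ ≤ s². The cruder s/ℓ in
place of s/√ℓ only affects constants. -/
lemma exists_norm_div_le_abs_coord {ℓ : ℕ} (v : Param ℓ) {s : ℝ} (hs : 0 < s) (h : s ≤ ‖v‖) :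
    ∃ j, s / ℓ ≤ |v j| := by
  by_contra! hcon
  rcases Nat.eq_zero_or_pos ℓ with rfl | hℓ
  · have : v = 0 := by ext j; exact j.elim0
    rw [this, norm_zero] at h
    linarith
  have hℓ' : (1 : ℝ) ≤ ℓ := by exact_mod_cast hℓ
  have hne : (Finset.univ : Finset (Fin ℓ)).Nonempty := ⟨⟨0, hℓ⟩, Finset.mem_univ _⟩
  have h1 : ‖v‖ ^ 2 < s ^ 2 := by
    rw [EuclideanSpace.norm_sq_eq]
    calc ∑ j, ‖v j‖ ^ 2 < ∑ _j : Fin ℓ, (s / ℓ) ^ 2 :=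
          Finset.sum_lt_sum_of_nonempty hne fun j _ =>
            pow_lt_pow_left₀ (hcon j) (abs_nonneg _) two_ne_zero
      _ = s ^ 2 / ℓ := by simp; field_simp
      _ ≤ s ^ 2 := div_le_self (sq_nonneg s) hℓ'
  have := pow_le_pow_left₀ hs.le h 2
  linarith

/-- The constant of the deviation inequality for the vector of sample moments. -/
noncomputable def momentsConst (ℓ : ℕ) (p c : ℝ) : ℝ :=
  ℓ * (meanConst (p / ℓ) * (ℓ / c) ^ (p / ℓ))

/-- The deviation inequality for the vector of the first `ℓ` sample moments. -/
lemma measure_sampleMoments_ge_le {ℓ : ℕ} (hℓ : 1 ≤ ℓ) {p : ℝ} (hp : 6 * (ℓ : ℝ) < p)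
    {Y : ℕ → Param ℓ → Ω → ℝ} {θ₀ : Param ℓ} (hm : ∀ i, Measurable (Y i θ₀))
    (hind : iIndepFun (fun i => Y i θ₀) P) (hst : WeaklyStationary ℓ P (fun i => Y i θ₀))
    (hfin : ∀ i, ∫⁻ ω, ‖Y i θ₀ ω‖ₑ ^ p ∂P < ∞) {c e : ℝ} (hc : 0 < c) (he : 0 < e)
    {n : ℕ} (hn : 1 ≤ n) :
    P {ω | c * e ≤ ‖sampleMoments Y θ₀ n ω - momentMap P Y θ₀‖} ≤
      ENNReal.ofReal (momentsConst ℓ p c) * ((cesaroMoment P Y θ₀ p n + lowerOrderTerm ℓ) /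
        ENNReal.ofReal (e ^ (p / ℓ) * (n : ℝ) ^ (p / (2 * ℓ) - 1))) := by
  have hℓ0 : (0 : ℝ) < ℓ := by exact_mod_cast hℓ
  have hn1 : (1 : ℝ) ≤ n := by exact_mod_cast hn
  have hn0 : (0 : ℝ) < n := by linarith
  have hp0 : 0 < p := by linarith
  have hr : 2 < p / ℓ := by rw [lt_div_iff₀ hℓ0]; linarith
  set r := p / ℓ with hrdef
  have hr0 : 0 < r := by linarith
  have hmc := meanConst_pos hr0
  have hint := fun i => (lintegral_enorm_rpow_eq hp0 (hm i) (hfin i)).1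
  set b : ℝ := (n : ℝ)⁻¹ * ∑ i ∈ Finset.range n, ∫ ω, |Y i θ₀ ω| ^ p ∂P with hb
  have hb0 : 0 ≤ b := mul_nonneg (by positivity)
    (Finset.sum_nonneg fun i _ => integral_nonneg fun ω => by positivity)
  have hces : cesaroMoment P Y θ₀ p n = ENNReal.ofReal b := by
    rw [cesaroMoment, Finset.sum_congr rfl fun i _ =>
      (lintegral_enorm_rpow_eq hp0 (hm i) (hfin i)).2,
      ← ENNReal.ofReal_sum_of_nonneg fun i _ => integral_nonneg fun ω => by positivity,
      ← ENNReal.ofReal_natCast, ← ENNReal.ofReal_div_of_pos hn0, hb, div_eq_inv_mul]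
  -- One power of n is given away here to match the denominator in `weightedSum`.
  have hpow : (n : ℝ) ^ (p / (2 * ℓ) - 1) ≤ (n : ℝ) ^ (r / 2) := by
    refine Real.rpow_le_rpow_of_exponent_le hn1 ?_
    rw [hrdef, div_div, mul_comm (ℓ : ℝ)]
    linarith
  have hbound : ∀ j : Fin ℓ, P {ω | c * e / ℓ ≤
      |(sampleMoments Y θ₀ n ω - momentMap P Y θ₀) j|} ≤
      ENNReal.ofReal (meanConst r * (ℓ / c) ^ r * ((b + lowerOrderTerm ℓ) /
        (e ^ r * (n : ℝ) ^ (p / (2 * ℓ) - 1)))) := by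
    intro j
    have hpt : ∀ y : ℝ, |y ^ (j.val + 1)| ^ r ≤ lowerOrderTerm ℓ + |y| ^ p := fun y =>
      abs_pow_rpow_le hp0 (by omega) (by omega) y
    have hdom : ∀ i, Integrable (fun ω => (lowerOrderTerm ℓ : ℝ) + |Y i θ₀ ω| ^ p) P :=
      fun i => (integrable_const _).add (hint i)
    have hWm : ∀ i, Measurable fun ω => Y i θ₀ ω ^ (j.val + 1) := fun i => (hm i).pow_const _
    have hWr : ∀ i, Integrable (fun ω => |Y i θ₀ ω ^ (j.val + 1)| ^ r) P := fun i =>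
      (hdom i).mono' (by have := hWm i; exact (by fun_prop : Measurable _).aestronglyMeasurable) (ae_of_all _ fun ω => by
        rw [Real.norm_eq_abs, abs_of_nonneg (by positivity)]
        exact hpt _)
    have hW : ∀ i, MemLp (fun ω => Y i θ₀ ω ^ (j.val + 1)) (ENNReal.ofReal r) P := fun i => by
      rw [← integrable_norm_rpow_iff (hWm i).aestronglyMeasurable (by simpa using hr0)
        ENNReal.ofReal_ne_top, ENNReal.toReal_ofReal hr0.le]
      exact hWr i
    have hindj : iIndepFun (fun i ω => Y i θ₀ ω ^ (j.val + 1)) P :=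
      hind.comp (fun _ x => x ^ (j.val + 1)) fun _ => by fun_prop
    have hmain := measure_mean_sub_ge_le hr hWm hindj hW
      (fun i => hst i (j.val + 1) (by omega) (by omega)) hn (by positivity : 0 < c * e / ℓ)
    have hWb : (n : ℝ)⁻¹ * ∑ i ∈ Finset.range n, ∫ ω, |Y i θ₀ ω ^ (j.val + 1)| ^ r ∂P ≤
        b + lowerOrderTerm ℓ := by
      calc _ ≤ (n : ℝ)⁻¹ * ∑ i ∈ Finset.range n,
            ((lowerOrderTerm ℓ : ℝ) + ∫ ω, |Y i θ₀ ω| ^ p ∂P) := by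
            refine mul_le_mul_of_nonneg_left (Finset.sum_le_sum fun i _ => ?_) (by positivity)
            refine (integral_mono (hWr i) (hdom i) fun ω => hpt _).trans_eq ?_
            rw [integral_add (integrable_const _) (hint i)]; simp
        _ = _ := by
            rw [Finset.sum_add_distrib, mul_add, ← hb]
            simp only [Finset.sum_const, Finset.card_range, nsmul_eq_mul]
            rw [inv_mul_cancel_left₀ hn0.ne', add_comm]
    refine hmain.trans (ENNReal.ofReal_le_ofReal ?_)
    calc _ ≤ meanConst r * (b + lowerOrderTerm ℓ) /
          ((c * e / ℓ) ^ r * (n : ℝ) ^ (p / (2 * ℓ) - 1)) := by gcongr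
      _ = _ := by
          rw [mul_div_right_comm c e, Real.mul_rpow (by positivity) he.le,
            Real.div_rpow hc.le hℓ0.le, Real.div_rpow hℓ0.le hc.le]
          field_simp
  calc _ ≤ P (⋃ j : Fin ℓ, {ω | c * e / ℓ ≤
        |(sampleMoments Y θ₀ n ω - momentMap P Y θ₀) j|}) := by
        refine measure_mono fun ω hω => ?_
        obtain ⟨j, hj⟩ := exists_norm_div_le_abs_coord _ (by positivity : 0 < c * e) hω
        exact Set.mem_iUnion.2 ⟨j, hj⟩
    _ ≤ ∑ j : Fin ℓ, P {ω | c * e / ℓ ≤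
        |(sampleMoments Y θ₀ n ω - momentMap P Y θ₀) j|} := measure_iUnion_fintype_le _ _
    _ ≤ ∑ _j : Fin ℓ, _ := Finset.sum_le_sum fun j _ => hbound j
    _ = _ := by
        rw [Finset.sum_const, Finset.card_univ, Fintype.card_fin, nsmul_eq_mul, hces,
          ← ENNReal.ofReal_natCast, ← ENNReal.ofReal_natCast,
          ← ENNReal.ofReal_add hb0 (Nat.cast_nonneg _),
          ← ENNReal.ofReal_div_of_pos (by positivity), ← ENNReal.ofReal_mul hℓ0.le,
          ← ENNReal.ofReal_mul (by unfold momentsConst; positivity), momentsConst]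
        congr 1; ring

end Deviation

/-! ### Passage from the estimator and its overlap count to the sample moments -/

/-- Pigeonhole: only k indices lie in [n₀, n₀ + k), so more than k exceedances cannot all occur
there. -/
lemma exists_exceedance_of_lt_overlap {ℓ : ℕ} {Ω : Type u} {Y : ℕ → Param ℓ → Ω → ℝ}
    {Minv : Param ℓ → Param ℓ} {θ₀ : Param ℓ} {ε : ℕ → ℝ} {n₀ k : ℕ} {ω : Ω}
    (h : (k : ℕ∞) < overlap Y Minv θ₀ ε n₀ ω) :
    ∃ m, n₀ + k ≤ m ∧ ε m < ‖estimator Y Minv θ₀ m ω - θ₀‖ := by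
  by_contra! hcon
  have hsub : {n : ℕ | n₀ ≤ n ∧ ε n < ‖estimator Y Minv θ₀ n ω - θ₀‖} ⊆
      (Finset.Ico n₀ (n₀ + k) : Set ℕ) := by
    rintro n ⟨hn, hlt⟩
    rw [Finset.coe_Ico]
    refine ⟨hn, ?_⟩
    by_contra! hge
    exact absurd hlt (not_lt.2 (hcon n hge))
  have := Set.encard_le_encard hsub
  rw [Set.encard_coe_eq_coe_finsetCard, Nat.card_Ico, Nat.add_sub_cancel_left] at this
  exact absurd h (not_lt.2 this)

section Estimation

variable {ℓ : ℕ} {Ω : Type u} [MeasurableSpace Ω] {P : Measure Ω}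
  {Θ : Set (Param ℓ)} {Y : ℕ → Param ℓ → Ω → ℝ} {Minv : Param ℓ → Param ℓ} {θ₀ : Param ℓ}
  {p : ℝ} {a ε : ℕ → ℝ} {n₀ : ℕ}

lemma contDiffAt_of_setting (hS : Setting P Θ Y Minv) (hθ : θ₀ ∈ Θ) :
    ContDiffAt ℝ 1 Minv (momentMap P Y θ₀) :=
  hS.contDiffOn.contDiffAt (hS.isOpen_image.mem_nhds ⟨θ₀, hθ, rfl⟩)

/-- For all small scales, deviations of the estimator reduce to deviations of the sample moments. -/
lemma exists_reduction (hS : Setting P Θ Y Minv) (hθ : θ₀ ∈ Θ)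
    (hε_pos : ∀ n, n₀ ≤ n → 0 < ε n) (hε_anti : AntitoneOn ε (Set.Ici n₀)) :
    ∃ c₀ > 0, ∀ c ≤ c₀, Reduction P Θ Y θ₀ ε n₀ c := by
  obtain ⟨L, t, ht, hL⟩ := (contDiffAt_of_setting hS hθ).exists_lipschitzOnWith
  obtain ⟨η, hη, hball⟩ := Metric.mem_nhds_iff.1
    (inter_mem ht (hS.isOpen_image.mem_nhds ⟨θ₀, hθ, rfl⟩))
  have hE := hε_pos n₀ le_rfl
  -- The first bound keeps all balls inside the Lipschitz neighbourhood, as ε n ≤ ε n₀; the second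
  -- makes L c < 1, also when L = 0.
  refine ⟨min (η / ε n₀) (1 / (L + 1)), lt_min (by positivity) (by positivity), ?_⟩
  intro c hc n hn
  rw [Set.compl_subset_compl]
  intro y hy
  have hεn := hε_pos n hn
  have hyd : dist y (momentMap P Y θ₀) < c * ε n := hy
  have hc1 : c * ε n ≤ η := by
    calc c * ε n ≤ η / ε n₀ * ε n := by
          gcongr; exact hc.trans (min_le_left _ _)
      _ ≤ η / ε n₀ * ε n₀ := by
          gcongr; exact hε_anti (Set.mem_Ici.2 le_rfl) (Set.mem_Ici.2 hn) hn
      _ = η := by field_simp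
  obtain ⟨hyt, θ, hθ', rfl⟩ := hball (show momentMap P Y θ₀ ∈ _ from Metric.mem_ball_self hη) |>.1 |>
    fun _ => hball (Metric.mem_ball.2 (hyd.trans_le hc1))
  have h0t : momentMap P Y θ₀ ∈ t := (hball (Metric.mem_ball_self hη)).1
  refine ⟨θ, ⟨hθ', ?_⟩, rfl⟩
  have hd := hL.dist_le_mul _ hyt _ h0t
  rw [hS.leftInv hθ', hS.leftInv hθ] at hd
  rw [Metric.mem_ball]
  have hc2 : c * ε n ≤ 1 / (L + 1) * ε n := by
    gcongr; exact hc.trans (min_le_right _ _)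
  have hL0 : (0 : ℝ) ≤ L := L.2
  calc dist θ θ₀ ≤ L * dist (momentMap P Y θ) (momentMap P Y θ₀) := hd
    _ ≤ L * (1 / (L + 1) * ε n) := by gcongr; exact hyd.le.trans hc2
    _ < ε n := by
        rw [← mul_assoc, mul_one_div]
        refine mul_lt_of_lt_one_left hεn ?_
        rw [div_lt_one (by positivity)]; linarith

/-- The arbitrary values of `Minv` off M(Θ) are harmless: sample moments outside M(Θ) already lie in
the complement to which the reduction applies. -/
lemma Reduction.le_norm_sub {c : ℝ} (hR : Reduction P Θ Y θ₀ ε n₀ c)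
    (hS : Setting P Θ Y Minv) {n : ℕ} (hn : n₀ ≤ n) {ω : Ω}
    (h : ε n < ‖estimator Y Minv θ₀ n ω - θ₀‖) :
    c * ε n ≤ ‖sampleMoments Y θ₀ n ω - momentMap P Y θ₀‖ := by
  have hmem : sampleMoments Y θ₀ n ω ∈ (momentMap P Y '' (Θ ∩ Metric.ball θ₀ (ε n)))ᶜ := by
    rintro ⟨θ, ⟨hθ, hball⟩, heq⟩
    rw [estimator, ← heq, hS.leftInv hθ] at h
    rw [Metric.mem_ball, dist_eq_norm] at hball
    linarith
  have := hR n hn hmem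
  rw [Set.mem_compl_iff, Metric.mem_ball, dist_eq_norm, not_lt] at this
  exact this

/-- The inner series of `weightedSum` converges. -/
lemma inner_sum_ne_top (ha_pos : ∀ n, n₀ ≤ n → 0 < a n)
    (hK : weightedSum P Y θ₀ p a ε n₀ < ∞) :
    ∑' m : Set.Ici n₀, cesaroMoment P Y θ₀ p m /
      ENNReal.ofReal (ε m ^ (p / ℓ) * ((m : ℕ) : ℝ) ^ (p / (2 * ℓ) - 1)) ≠ ∞ := by
  have h := ENNReal.ne_top_of_tsum_ne_top hK.ne ⟨n₀, Set.mem_Ici.2 le_rfl⟩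
  refine (ENNReal.lt_top_of_mul_ne_top_right h ?_).ne
  simpa using ha_pos n₀ le_rfl

lemma lintegral_rpow_lt_top (ha_pos : ∀ n, n₀ ≤ n → 0 < a n)
    (hK : weightedSum P Y θ₀ p a ε n₀ < ∞) (i : ℕ) :
    ∫⁻ ω, ‖Y i θ₀ ω‖ₑ ^ p ∂P < ∞ := by
  -- The index i + 1 is the first whose Cesàro mean contains the i-th moment.
  have hm : n₀ ≤ max n₀ (i + 1) := le_max_left _ _
  have h := ENNReal.ne_top_of_tsum_ne_top (inner_sum_ne_top ha_pos hK) ⟨_, Set.mem_Ici.2 hm⟩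
  have h2 : cesaroMoment P Y θ₀ p (max n₀ (i + 1)) ≠ ∞ := by
    intro htop
    simp only [htop] at h
    exact h (ENNReal.top_div_of_ne_top ENNReal.ofReal_ne_top)
  rw [cesaroMoment] at h2
  have h3 : ∑ i ∈ Finset.range (max n₀ (i + 1)), ∫⁻ ω, ‖Y i θ₀ ω‖ₑ ^ p ∂P ≠ ∞ := by
    intro htop
    rw [htop] at h2
    exact h2 (ENNReal.top_div_of_ne_top (ENNReal.natCast_ne_top _))
  exact ENNReal.sum_lt_top.1 (lt_top_iff_ne_top.2 h3) i (by simp)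

/-- In dimension at least two the second moment is positive, since `M(Θ)` is open. -/
lemma integral_sq_pos (hS : Setting P Θ Y Minv) (hθ : θ₀ ∈ Θ) (hℓ : 2 ≤ ℓ) :
    0 < ∫ ω, Y 0 θ₀ ω ^ 2 ∂P := by
  by_contra! hle
  set k : Fin ℓ := ⟨1, hℓ⟩
  obtain ⟨η, hη, hball⟩ := Metric.isOpen_iff.1 hS.isOpen_image _ ⟨θ₀, hθ, rfl⟩
  -- If the second moment at θ₀ were zero, lowering that coordinate by η/2 would stay in M(Θ) and
  -- give some θ a negative second moment.
  obtain ⟨θ, -, heq⟩ := hball (show momentMap P Y θ₀ - EuclideanSpace.single k (η / 2) ∈ _ by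
    rw [Metric.mem_ball, dist_eq_norm, sub_sub_cancel_left, norm_neg, PiLp.norm_single,
      Real.norm_eq_abs, abs_of_pos (by positivity)]
    linarith)
  have hk := congrArg (fun v : Param ℓ => v k) heq
  simp only [momentMap, PiLp.sub_apply, PiLp.single_apply, if_true, k] at hk
  have : 0 ≤ ∫ ω, Y 0 θ ω ^ 2 ∂P := integral_nonneg fun ω => sq_nonneg _
  norm_num at hk this hle
  linarith

lemma antiderivative_overlap_le (hS : Setting P Θ Y Minv) {c : ℝ}
    (hR : Reduction P Θ Y θ₀ ε n₀ c) (ω : Ω) :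
    antiderivative a n₀ (overlap Y Minv θ₀ ε n₀ ω) ≤
      ∑' n : Set.Ici n₀, ENNReal.ofReal (a n) * ∑' m : Set.Ici (n : ℕ),
        {ω | c * ε m ≤ ‖sampleMoments Y θ₀ m ω - momentMap P Y θ₀‖}.indicator 1 ω := by
  have hinj : Function.Injective fun k : ℕ => (⟨n₀ + k, by simp⟩ : Set.Ici n₀) := fun i j h => by
    simpa using h
  refine le_trans (ENNReal.tsum_le_tsum fun k => ?_)
    (ENNReal.tsum_comp_le_tsum_of_injective hinj _)
  split_ifs with h
  · obtain ⟨m, hm, hlt⟩ := exists_exceedance_of_lt_overlap h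
    refine le_mul_of_one_le_right' ?_
    refine le_trans ?_ (ENNReal.le_tsum (⟨m, hm⟩ : Set.Ici (n₀ + k)))
    rw [Set.indicator_of_mem]
    · rfl
    · exact hR.le_norm_sub hS (le_trans (Nat.le_add_right _ _) hm) hlt
  · exact zero_le

/-! ### Summability, almost sure convergence and the mean overlap bound -/

variable [IsProbabilityMeasure P]

/-- The correction term is dominated by the Cesàro means of the `p`-th moments. -/
lemma exists_lowerOrderTerm_le (hS : Setting P Θ Y Minv) (hθ : θ₀ ∈ Θ) (hℓ : 1 ≤ ℓ) (hp : 2 < p)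
    (hfin : ∀ i, ∫⁻ ω, ‖Y i θ₀ ω‖ₑ ^ p ∂P < ∞) :
    ∃ B : ℝ, ∀ n, 1 ≤ n →
      (lowerOrderTerm ℓ : ℝ≥0∞) ≤ ENNReal.ofReal B * cesaroMoment P Y θ₀ p n := by
  rcases hℓ.eq_or_lt with rfl | hℓ2
  · exact ⟨0, by simp [lowerOrderTerm]⟩
  have hv := integral_sq_pos hS hθ hℓ2
  -- Half of the second moment: integrating the bound `hpt` below gives 2s ≤ s + s^(1 - p/2)
  -- E|Y_i|^p, and one s is absorbed.
  set s := (∫ ω, Y 0 θ₀ ω ^ 2 ∂P) / 2 with hs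
  have hs0 : 0 < s := by positivity
  have hpt : ∀ y : ℝ, y ^ 2 ≤ s + s ^ (1 - p / 2) * |y| ^ p := by
    intro y
    have hnn : 0 ≤ s ^ (1 - p / 2) * |y| ^ p := by positivity
    rcases le_or_gt (y ^ 2) s with h | h
    · linarith
    · have hy2 : 0 < y ^ 2 := hs0.trans h
      have e : |y| ^ p = y ^ 2 * (y ^ 2) ^ (p / 2 - 1) := by
        rw [← Real.rpow_one_add' hy2.le (by linarith), ← sq_abs, ← Real.rpow_natCast,
          ← Real.rpow_mul (abs_nonneg y)]
        congr 1; push_cast; ring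
      have e2 : s ^ (1 - p / 2) * s ^ (p / 2 - 1) = 1 := by
        rw [← Real.rpow_add hs0]; simp
      have e3 : s ^ (p / 2 - 1) ≤ (y ^ 2) ^ (p / 2 - 1) :=
        Real.rpow_le_rpow hs0.le h.le (by linarith)
      have e4 : 1 ≤ s ^ (1 - p / 2) * (y ^ 2) ^ (p / 2 - 1) := by
        calc 1 = s ^ (1 - p / 2) * s ^ (p / 2 - 1) := e2.symm
          _ ≤ _ := by gcongr
      rw [e]; nlinarith
  have hb : ∀ i, ENNReal.ofReal s ≤
      ENNReal.ofReal (s ^ (1 - p / 2)) * ∫⁻ ω, ‖Y i θ₀ ω‖ₑ ^ p ∂P := by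
    intro i
    obtain ⟨hi, he⟩ := lintegral_enorm_rpow_eq (by linarith) (hS.measurable i θ₀ hθ) (hfin i)
    rw [he, ← ENNReal.ofReal_mul (by positivity)]
    refine ENNReal.ofReal_le_ofReal ?_
    have hdom : Integrable (fun ω => s + s ^ (1 - p / 2) * |Y i θ₀ ω| ^ p) P :=
      (integrable_const _).add (hi.const_mul _)
    have hsq : Integrable (fun ω => Y i θ₀ ω ^ 2) P :=
      hdom.mono' ((hS.measurable i θ₀ hθ).pow_const 2).aestronglyMeasurable
        (ae_of_all _ fun ω => by
          rw [Real.norm_eq_abs, abs_of_nonneg (sq_nonneg _)]; exact hpt _)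
    have h1 := integral_mono hsq hdom fun ω => hpt _
    rw [hS.stationary θ₀ hθ i 2 (by norm_num) hℓ2,
      integral_add (integrable_const _) (hi.const_mul _), integral_const_mul] at h1
    simp only [integral_const, probReal_univ, one_smul] at h1
    linarith
  refine ⟨s⁻¹ * s ^ (1 - p / 2), fun n hn => ?_⟩
  have hn0 : (n : ℝ≥0∞) ≠ 0 := by simpa using (by omega : n ≠ 0)
  have hnt : (n : ℝ≥0∞) ≠ ∞ := ENNReal.natCast_ne_top n
  have h1 : (n : ℝ≥0∞) * ENNReal.ofReal s ≤ ENNReal.ofReal (s ^ (1 - p / 2)) *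
      ∑ i ∈ Finset.range n, ∫⁻ ω, ‖Y i θ₀ ω‖ₑ ^ p ∂P := by
    rw [Finset.mul_sum]
    refine le_trans ?_ (Finset.sum_le_sum fun i _ => hb i)
    simp
  calc (lowerOrderTerm ℓ : ℝ≥0∞) ≤ 1 := by
        rw [lowerOrderTerm]; split_ifs <;> simp
    _ = ENNReal.ofReal s⁻¹ * ENNReal.ofReal s := by
        rw [← ENNReal.ofReal_mul (by positivity), inv_mul_cancel₀ hs0.ne', ENNReal.ofReal_one]
    _ ≤ ENNReal.ofReal s⁻¹ * (ENNReal.ofReal (s ^ (1 - p / 2)) * cesaroMoment P Y θ₀ p n) := by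
        gcongr
        rw [cesaroMoment, ← mul_div_assoc, ENNReal.le_div_iff_mul_le (Or.inl hn0) (Or.inl hnt),
          mul_comm]
        exact h1
    _ = _ := by rw [← mul_assoc, ← ENNReal.ofReal_mul (by positivity)]

/-- The analogue of `weightedSum` with the moments replaced by the correction term. -/
noncomputable def lowerOrderSum (ℓ : ℕ) (p : ℝ) (a ε : ℕ → ℝ) (n₀ : ℕ) : ℝ≥0∞ :=
  ∑' n : Set.Ici n₀, ENNReal.ofReal (a n) * ∑' m : Set.Ici (n : ℕ), (lowerOrderTerm ℓ : ℝ≥0∞) /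
    ENNReal.ofReal (ε m ^ (p / ℓ) * ((m : ℕ) : ℝ) ^ (p / (2 * ℓ) - 1))

lemma lowerOrderSum_lt_top (hS : Setting P Θ Y Minv) (hθ : θ₀ ∈ Θ) (hℓ : 1 ≤ ℓ) (hp : 2 < p)
    (hn₀ : 1 ≤ n₀) (ha_pos : ∀ n, n₀ ≤ n → 0 < a n) (hK : weightedSum P Y θ₀ p a ε n₀ < ∞) :
    lowerOrderSum ℓ p a ε n₀ < ∞ := by
  obtain ⟨B, hB⟩ := exists_lowerOrderTerm_le hS hθ hℓ hp (lintegral_rpow_lt_top ha_pos hK)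
  refine lt_of_le_of_lt ?_ (ENNReal.mul_lt_top (ENNReal.ofReal_lt_top (r := B)) hK)
  rw [lowerOrderSum, weightedSum, ← ENNReal.tsum_mul_left]
  refine ENNReal.tsum_le_tsum fun n => ?_
  rw [mul_left_comm, ← ENNReal.tsum_mul_left (a := ENNReal.ofReal B)]
  refine mul_le_mul_right (ENNReal.tsum_le_tsum fun m => ?_) _
  rw [← mul_div_assoc]
  exact ENNReal.div_le_div_right (hB m (hn₀.trans (le_trans n.2 m.2))) _

lemma tsum_measure_ne_top (hS : Setting P Θ Y Minv) (hθ : θ₀ ∈ Θ) (hℓ : 1 ≤ ℓ)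
    (hp : 6 * (ℓ : ℝ) < p) (hn₀ : 1 ≤ n₀) (ha_pos : ∀ n, n₀ ≤ n → 0 < a n)
    (hε_pos : ∀ n, n₀ ≤ n → 0 < ε n) (hK : weightedSum P Y θ₀ p a ε n₀ < ∞) {c : ℝ} (hc : 0 < c) :
    ∑' m : Set.Ici n₀, P {ω | c * ε m ≤ ‖sampleMoments Y θ₀ m ω - momentMap P Y θ₀‖} ≠ ∞ := by
  have hℓ1 : (1 : ℝ) ≤ ℓ := by exact_mod_cast hℓ
  have hfin := lintegral_rpow_lt_top ha_pos hK
  obtain ⟨B, hB⟩ := exists_lowerOrderTerm_le hS hθ hℓ (by linarith) hfin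
  refine ne_top_of_le_ne_top (ENNReal.mul_ne_top (ENNReal.mul_ne_top
    (ENNReal.ofReal_ne_top (r := momentsConst ℓ p c))
    (ENNReal.add_ne_top.2 ⟨ENNReal.one_ne_top, ENNReal.ofReal_ne_top (r := B)⟩))
    (inner_sum_ne_top ha_pos hK)) ?_
  rw [← ENNReal.tsum_mul_left]
  refine ENNReal.tsum_le_tsum fun m => ?_
  have hm1 : 1 ≤ (m : ℕ) := hn₀.trans m.2
  refine (measure_sampleMoments_ge_le hℓ hp (fun i => hS.measurable i θ₀ hθ) (hS.indep θ₀ hθ)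
    (hS.stationary θ₀ hθ) hfin hc (hε_pos m m.2) hm1).trans ?_
  rw [mul_assoc, add_mul, one_mul, ← mul_div_assoc (ENNReal.ofReal B), ← ENNReal.add_div]
  exact mul_le_mul_right (ENNReal.div_le_div_right (add_le_add_right (hB m hm1) _) _) _

/-- Deviations of the sample moments of size `c * ε n` occur only finitely often. -/
lemma ae_eventually_norm_lt (hS : Setting P Θ Y Minv) (hθ : θ₀ ∈ Θ) (hℓ : 1 ≤ ℓ)
    (hp : 6 * (ℓ : ℝ) < p) (hn₀ : 1 ≤ n₀) (ha_pos : ∀ n, n₀ ≤ n → 0 < a n)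
    (hε_pos : ∀ n, n₀ ≤ n → 0 < ε n) (hK : weightedSum P Y θ₀ p a ε n₀ < ∞) {c : ℝ} (hc : 0 < c) :
    ∀ᵐ ω ∂P, ∀ᶠ n in atTop, ‖sampleMoments Y θ₀ n ω - momentMap P Y θ₀‖ < c * ε n := by
  have h := tsum_measure_ne_top hS hθ hℓ hp hn₀ ha_pos hε_pos hK hc
  rw [tsum_subtype (Set.Ici n₀) fun m =>
    P {ω | c * ε m ≤ ‖sampleMoments Y θ₀ m ω - momentMap P Y θ₀‖}] at h
  have hbc := ae_eventually_notMem (μ := P) (s := fun m =>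
    -- Including n₀ ≤ m empties the events below n₀, where nothing is known about ε.
    {ω | n₀ ≤ m ∧ c * ε m ≤ ‖sampleMoments Y θ₀ m ω - momentMap P Y θ₀‖}) (by
      refine ne_top_of_le_ne_top h (ENNReal.tsum_le_tsum fun m => ?_)
      by_cases hm : n₀ ≤ m
      · rw [Set.indicator_of_mem (Set.mem_Ici.2 hm)]
        exact measure_mono fun ω hω => hω.2
      · simp [hm])
  filter_upwards [hbc] with ω hω
  filter_upwards [hω, eventually_ge_atTop n₀] with n hn hn'
  by_contra! hcon
  exact hn ⟨hn', hcon⟩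

lemma measurable_sampleMoments (hm : ∀ i, Measurable (Y i θ₀)) (n : ℕ) :
    Measurable (sampleMoments Y θ₀ n) := by
  unfold sampleMoments
  fun_prop

lemma ae_tendsto_sampleMoments (hS : Setting P Θ Y Minv) (hθ : θ₀ ∈ Θ) (hℓ : 1 ≤ ℓ)
    (hp : 6 * (ℓ : ℝ) < p) (hn₀ : 1 ≤ n₀) (ha_pos : ∀ n, n₀ ≤ n → 0 < a n)
    (hε_pos : ∀ n, n₀ ≤ n → 0 < ε n) (hε_anti : AntitoneOn ε (Set.Ici n₀))
    (hK : weightedSum P Y θ₀ p a ε n₀ < ∞) :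
    ∀ᵐ ω ∂P, Tendsto (fun n => sampleMoments Y θ₀ n ω) atTop (𝓝 (momentMap P Y θ₀)) := by
  -- Since ε need not tend to zero, convergence comes from letting the factor c run through 1/(k +
  -- 1), with ε n ≤ ε n₀.
  have h : ∀ᵐ ω ∂P, ∀ k : ℕ, ∀ᶠ n in atTop,
      ‖sampleMoments Y θ₀ n ω - momentMap P Y θ₀‖ < 1 / ((k : ℝ) + 1) * ε n :=
    ae_all_iff.2 fun k => ae_eventually_norm_lt hS hθ hℓ hp hn₀ ha_pos hε_pos hK (by positivity)
  filter_upwards [h] with ω hω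
  rw [Metric.tendsto_nhds]
  intro η hη
  have hE := hε_pos n₀ le_rfl
  obtain ⟨k, hk⟩ := exists_nat_one_div_lt (div_pos hη hE)
  filter_upwards [hω k, eventually_ge_atTop n₀] with n hn hn'
  rw [dist_eq_norm]
  calc _ < 1 / ((k : ℝ) + 1) * ε n := hn
    _ ≤ 1 / ((k : ℝ) + 1) * ε n₀ := by
        gcongr; exact hε_anti (Set.mem_Ici.2 le_rfl) (Set.mem_Ici.2 hn') hn'
    _ ≤ η / ε n₀ * ε n₀ := by gcongr
    _ = η := by field_simp

/-- The moment bound for the overlap statistic. -/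
lemma lintegral_antiderivative_overlap_le (hS : Setting P Θ Y Minv) (hθ : θ₀ ∈ Θ) (hℓ : 1 ≤ ℓ)
    (hp : 6 * (ℓ : ℝ) < p) (hn₀ : 1 ≤ n₀) (ha_pos : ∀ n, n₀ ≤ n → 0 < a n)
    (hε_pos : ∀ n, n₀ ≤ n → 0 < ε n) (hK : weightedSum P Y θ₀ p a ε n₀ < ∞) {c : ℝ} (hc : 0 < c)
    (hR : Reduction P Θ Y θ₀ ε n₀ c) :
    ∫⁻ ω, antiderivative a n₀ (overlap Y Minv θ₀ ε n₀ ω) ∂P ≤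
      ENNReal.ofReal (momentsConst ℓ p c) * weightedSum P Y θ₀ p a ε n₀ +
        ENNReal.ofReal (momentsConst ℓ p c) * lowerOrderSum ℓ p a ε n₀ := by
  have hfin := lintegral_rpow_lt_top ha_pos hK
  have hmeas : ∀ m, MeasurableSet
      {ω | c * ε m ≤ ‖sampleMoments Y θ₀ m ω - momentMap P Y θ₀‖} := fun m =>
    measurableSet_le measurable_const
      ((measurable_sampleMoments (fun i => hS.measurable i θ₀ hθ) m).sub_const _).norm
  -- The majorant is measurable, so measurability of the overlap, and hence of `Minv`, is not
  -- required.
  refine (lintegral_mono fun ω => antiderivative_overlap_le hS hR ω).trans ?_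
  have hind : ∀ m, Measurable
      ({ω | c * ε m ≤ ‖sampleMoments Y θ₀ m ω - momentMap P Y θ₀‖}.indicator (1 : Ω → ℝ≥0∞)) :=
    fun m => measurable_one.indicator (hmeas m)
  rw [lintegral_tsum fun n => ((Measurable.tsum fun m => hind _).const_mul _).aemeasurable,
    weightedSum, lowerOrderSum, ← mul_add, ← ENNReal.tsum_add, ← ENNReal.tsum_mul_left]
  refine ENNReal.tsum_le_tsum fun n => ?_
  rw [lintegral_const_mul _ (Measurable.tsum fun m => hind _),
    lintegral_tsum fun m => (hind _).aemeasurable, ← mul_add, mul_left_comm, ← ENNReal.tsum_add,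
    ← ENNReal.tsum_mul_left (a := ENNReal.ofReal (momentsConst ℓ p c))]
  refine mul_le_mul_right (ENNReal.tsum_le_tsum fun m => ?_) _
  have hm0 : n₀ ≤ (m : ℕ) := le_trans n.2 m.2
  rw [lintegral_indicator_one (hmeas m), ← ENNReal.add_div]
  exact measure_sampleMoments_ge_le hℓ hp (fun i => hS.measurable i θ₀ hθ) (hS.indep θ₀ hθ)
    (hS.stationary θ₀ hθ) hfin hc (hε_pos m hm0) (hn₀.trans hm0)

end Estimation

end MethodOfMoments

/-! ### Assembly of the theorem -/

theorem mainTheorem10 (ℓ : ℕ) (hℓ : 1 ≤ ℓ) (p : ℝ) (hp : 6 * (ℓ : ℝ) < p)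
    (n₀ : ℕ) (hn₀ : 1 ≤ n₀) (a ε : ℕ → ℝ)
    (ha_pos : ∀ n, n₀ ≤ n → 0 < a n) (ha_mono : MonotoneOn a (Set.Ici n₀))
    (hε_pos : ∀ n, n₀ ≤ n → 0 < ε n) (hε_anti : AntitoneOn ε (Set.Ici n₀)) :
    (∀ (Ω : Type u) [MeasurableSpace Ω] (P : Measure Ω) [IsProbabilityMeasure P]
        (Θ : Set (Param ℓ)) (Y : ℕ → Param ℓ → Ω → ℝ) (Minv : Param ℓ → Param ℓ),
        MethodOfMoments.Setting P Θ Y Minv → ∀ θ₀ ∈ Θ,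
        MethodOfMoments.weightedSum P Y θ₀ p a ε n₀ < ∞ →
        (∀ᵐ ω ∂P, Tendsto (fun n => MethodOfMoments.estimator Y Minv θ₀ n ω) atTop (𝓝 θ₀)) ∧
        (∀ᵐ ω ∂P, limsup (fun n => ENNReal.ofReal
          (‖MethodOfMoments.estimator Y Minv θ₀ n ω - θ₀‖ * (ε n)⁻¹)) atTop ≤ 1) ∧
        (∀ lam : ℝ, 0 < lam → ∃ δ₁ ∈ Set.Ioo (0 : ℝ) 1, ∃ δ₂ ∈ Set.Ioo (0 : ℝ) 1,
          MethodOfMoments.Reduction P Θ Y θ₀ ε n₀ (δ₁ * δ₂ * lam))) ∧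
    (∀ lam : ℝ, 0 < lam → ∀ δ₁ ∈ Set.Ioo (0 : ℝ) 1, ∀ δ₂ ∈ Set.Ioo (0 : ℝ) 1,
      ∃ C₁ C₂ : ℝ, 0 < C₁ ∧ 0 < C₂ ∧
        ∀ (Ω : Type u) [MeasurableSpace Ω] (P : Measure Ω) [IsProbabilityMeasure P]
          (Θ : Set (Param ℓ)) (Y : ℕ → Param ℓ → Ω → ℝ) (Minv : Param ℓ → Param ℓ),
          MethodOfMoments.Setting P Θ Y Minv → ∀ θ₀ ∈ Θ,
          MethodOfMoments.Reduction P Θ Y θ₀ ε n₀ (δ₁ * δ₂ * lam) →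
          MethodOfMoments.weightedSum P Y θ₀ p a ε n₀ < ∞ →
          ∫⁻ ω, MethodOfMoments.antiderivative a n₀
              (MethodOfMoments.overlap Y Minv θ₀ ε n₀ ω) ∂P ≤
            ENNReal.ofReal C₁ * MethodOfMoments.weightedSum P Y θ₀ p a ε n₀ +
              ENNReal.ofReal C₂) := by
  refine ⟨?_, ?_⟩
  · intro Ω _ P _ Θ Y Minv hS θ₀ hθ hK
    obtain ⟨c₀, hc₀, hred⟩ := MethodOfMoments.exists_reduction hS hθ hε_pos hε_anti
    refine ⟨?_, ?_, ?_⟩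
    · filter_upwards [MethodOfMoments.ae_tendsto_sampleMoments hS hθ hℓ hp hn₀ ha_pos hε_pos
        hε_anti hK] with ω hω
      have h := (MethodOfMoments.contDiffAt_of_setting hS hθ).continuousAt.tendsto.comp hω
      rwa [hS.leftInv hθ] at h
    · filter_upwards [MethodOfMoments.ae_eventually_norm_lt hS hθ hℓ hp hn₀ ha_pos hε_pos hK
        hc₀] with ω hω
      refine limsup_le_of_le (by isBoundedDefault) ?_
      filter_upwards [hω, eventually_ge_atTop n₀] with n hn hn'
      rw [← ENNReal.ofReal_one]
      refine ENNReal.ofReal_le_ofReal ?_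
      rw [← div_eq_mul_inv, div_le_one (hε_pos n hn')]
      by_contra! hlt
      exact absurd hn (not_lt.2 ((hred c₀ le_rfl).le_norm_sub hS hn' hlt))
    · intro lam hlam
      -- These factors give δ₁ δ₂ λ ≤ c₀ / 2.
      refine ⟨1 / 2, by norm_num, min (1 / 2) (c₀ / lam),
        ⟨by positivity, (min_le_left _ _).trans_lt (by norm_num)⟩, hred _ ?_⟩
      calc 1 / 2 * min (1 / 2) (c₀ / lam) * lam ≤ 1 / 2 * (c₀ / lam) * lam := by
            gcongr; exact min_le_right _ _
        _ = c₀ / 2 := by field_simp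
        _ ≤ c₀ := by linarith
  · intro lam hlam δ₁ hδ₁ δ₂ hδ₂
    have hc : 0 < δ₁ * δ₂ * lam := mul_pos (mul_pos hδ₁.1 hδ₂.1) hlam
    have hℓ0 : (1 : ℝ) ≤ ℓ := by exact_mod_cast hℓ
    set D := MethodOfMoments.momentsConst ℓ p (δ₁ * δ₂ * lam) with hD
    have hD0 : 0 < D := by
      have := MethodOfMoments.meanConst_pos (r := p / ℓ) (div_pos (by linarith) (by linarith))
      rw [hD, MethodOfMoments.momentsConst]
      positivity
    -- C₂ is chosen before any probability space. If the sum is infinite, `toReal` returns 0, but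
    -- then no admissible setting has K < ∞; the added 1 ensures positivity.
    refine ⟨D, D * (MethodOfMoments.lowerOrderSum ℓ p a ε n₀).toReal + 1, hD0, by positivity, ?_⟩
    intro Ω _ P _ Θ Y Minv hS θ₀ hθ hR hK
    have hT := MethodOfMoments.lowerOrderSum_lt_top hS hθ hℓ (by linarith) hn₀ ha_pos hK
    refine (MethodOfMoments.lintegral_antiderivative_overlap_le hS hθ hℓ hp hn₀ ha_pos hε_pos hK
      hc hR).trans ?_
    gcongr
    conv_lhs => rw [← ENNReal.ofReal_toReal hT.ne, ← ENNReal.ofReal_mul hD0.le]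
    exact ENNReal.ofReal_le_ofReal (by linarith)
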